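/- Let $\mu$ be a probability measure on $\mathbb R$ with cumulative distribution function $F(x)=\mu((-\infty,x])$ and quantile function $F^{-1}(u)=\inf\{x\in\mathbb R: F(x)\ge u\}$ for $u\in(0,1)$. Set $F^{-1}(0+)=\lim_{u\to0+}F^{-1}(u)\in[-\infty,+\infty)$ and $F^{-1}(1)=\lim_{u\to1-}F^{-1}(u)\in(-\infty,+\infty]$. For $\rho\ge1$ and $N\ge1$ let $$e_N(\mu,\rho)=\inf\Big\{\mathcal W_\rho\Big(\frac1N\sum_{i=1}^N\delta_{x_i},\mu\Big): -\infty<x_1\le\cdots\le x_N<+\infty\Big\}\in[0,+\infty],$$ where $\mathcal W_\rho(\nu,\eta)=\inf_\pi\big(\int_{\mathbb R^2}|x-y|^\rho\,\pi(dx,dy)\big)^{1/\rho}$, the infimum being over all couplings $\pi$ of $\nu$ and $\eta$, is the Wasserstein distance of index $\rho$. ($e_N(\mu,\rho)$ is finite when $\int_{\mathbb R}|x|^\rho\mu(dx)<+\infty$.) Then: (1) For each $\rho\ge1$, $$\sup_{N\ge1}N^{1/\rho}e_N(\mu,\rho)\le\frac{F^{-1}(1)-F^{-1}(0+)}{2^{1/\rho}}$$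 (as an inequality in $[0,+\infty]$). (2) $F^{-1}$ is discontinuous on $(0,1)$ if and only if $F$ is constant on some interval of positive length included in $\{x\in\mathbb R:0<F(x)<1\}$; and in this case, for each $\rho\ge1$, $\limsup_{N\to+\infty}N^{1/\rho}e_N(\mu,\rho)>0$. (3) $F^{-1}$ is continuous on $(0,1)$ if and only if $F$ is (strictly) increasing on $\{x\in\mathbb R:0<F(x)<1\}$; and if in this case $\mu$ is moreover compactly supported, then for each $\rho>1$, $\lim_{N\to+\infty}N^{1/\rho}e_N(\mu,\rho)=0$. -/

import Mathlib

open Set Filter Topology MeasureTheory ProbabilityTheory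
open scoped ENNReal

namespace EmpiricalApprox

/-- The quantile function `F⁻¹(u) = inf {x ∈ ℝ : u ≤ F(x)}`, for `u ∈ (0,1)`, where
`F = cdf μ` is the cumulative distribution function of the probability measure `μ`. -/
noncomputable def quantile (μ : Measure ℝ) (u : ℝ) : ℝ :=
  sInf {x : ℝ | u ≤ cdf μ x}

/-- `F⁻¹(0+)`, the right-hand limit at `0` of the quantile function, in `[-∞, +∞)`. -/
noncomputable def quantileZeroPlus (μ : Measure ℝ) : EReal :=
  Function.rightLim (fun u : ℝ => (quantile μ u : EReal)) 0

/-- `F⁻¹(1)`, defined as the left-hand limit at `1` of the quantile function, in `(-∞, +∞]`. -/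
noncomputable def quantileOne (μ : Measure ℝ) : EReal :=
  Function.leftLim (fun u : ℝ => (quantile μ u : EReal)) 1

/-- The Wasserstein distance of index `ρ` between two measures on the real line, with values in
`[0, +∞]`: the infimum over all couplings `π` of `(∫ |x - y|^ρ dπ(x,y))^(1/ρ)`. -/
noncomputable def wasserstein (ρ : ℝ) (ν η : Measure ℝ) : ℝ≥0∞ :=
  ⨅ (π : Measure (ℝ × ℝ)) (_ : π.map Prod.fst = ν ∧ π.map Prod.snd = η),
    (∫⁻ p, ENNReal.ofReal |p.1 - p.2| ^ ρ ∂π) ^ (1 / ρ)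

/-- The empirical measure `(1/N) ∑ δ_{x_i}`. -/
noncomputable def empirical {N : ℕ} (x : Fin N → ℝ) : Measure ℝ :=
  (N : ℝ≥0∞)⁻¹ • ∑ i, Measure.dirac (x i)

/-- `e_N(μ,ρ)`: the minimal Wasserstein error of approximation of `μ` by the empirical measure of
`N` points `x_1 ≤ ⋯ ≤ x_N`. -/
noncomputable def minError (N : ℕ) (μ : Measure ℝ) (ρ : ℝ) : ℝ≥0∞ :=
  ⨅ (x : Fin N → ℝ) (_ : Monotone x), wasserstein ρ (empirical x) μ

/-- The defining infimum of the quantile function is a genuine one on `(0,1)`. -/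
theorem isGLB_quantile (μ : Measure ℝ) {u : ℝ} (hu : u ∈ Ioo (0 : ℝ) 1) :
    IsGLB {x : ℝ | u ≤ cdf μ x} (quantile μ u) := by
  apply isGLB_csInf
  · obtain ⟨x, hx⟩ := ((tendsto_cdf_atTop μ).eventually (lt_mem_nhds hu.2)).exists
    exact ⟨x, hx.le⟩
  · obtain ⟨a, ha⟩ := ((tendsto_cdf_atBot μ).eventually (gt_mem_nhds hu.1)).exists
    refine ⟨a, fun x hx => ?_⟩
    by_contra! h
    exact absurd (hx.trans (monotone_cdf μ h.le)) (not_le.2 ha)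

theorem monotoneOn_quantile (μ : Measure ℝ) :
    MonotoneOn (fun u : ℝ => (quantile μ u : EReal)) (Ioo 0 1) := by
  intro u hu v hv huv
  refine EReal.coe_le_coe_iff.2 ((isGLB_quantile μ hv).2 fun x hx => ?_)
  exact (isGLB_quantile μ hu).1 (huv.trans hx)

/-- The limit defining `F⁻¹(0+)` exists. -/
theorem tendsto_quantileZeroPlus (μ : Measure ℝ) :
    Tendsto (fun u : ℝ => (quantile μ u : EReal)) (𝓝[>] 0) (𝓝 (quantileZeroPlus μ)) :=
  tendsto_rightLim_of_tendsto ⟨_, (monotoneOn_quantile μ).tendsto_nhdsWithin_Ioo_right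
    (nonempty_Ioo.2 zero_lt_one) (OrderBot.bddBelow _)⟩

/-- The limit defining `F⁻¹(1)` exists. -/
theorem tendsto_quantileOne (μ : Measure ℝ) :
    Tendsto (fun u : ℝ => (quantile μ u : EReal)) (𝓝[<] 1) (𝓝 (quantileOne μ)) :=
  tendsto_leftLim_of_tendsto ⟨_, (monotoneOn_quantile μ).tendsto_nhdsWithin_Ioo_left
    (nonempty_Ioo.2 zero_lt_one) (OrderTop.bddAbove _)⟩

end EmpiricalApprox

namespace EmpiricalApprox

/-! Upper bounds: the quantile function `G` pushes the uniform law on `(0,1)` to `μ`. Cut `(0,1]`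
into `N` equal cells and send each cell to the value of `G` at its midpoint. Monotonicity on the two
halves of a cell, with superadditivity of `t ↦ t ^ ρ`, gives `N * e_N ^ ρ ≤ (1/2) ∑ (ΔG) ^ ρ`
(`rpow_mul_minError_le`). Superadditivity again bounds the sum by the `ρ`-th power of the total
increment. If `G` extends continuously to `[0,1]` and `ρ > 1`, the sum is at most `(max ΔG) ^ (ρ -
1)` times the total increment, so it vanishes by uniform continuity.

Lower bound: jumps of `G` are flat pieces of `F` at a level `c` in `(0,1)`. An empirical measure has
mass `k / N` to the left of a gap where `μ` has mass `c`, so any coupling moves mass at least `|k /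
N - c|` over a fixed distance. Since `N * c` and `(N + 1) * c` cannot both be close to integers, `N
* e_N ^ ρ` stays away from `0` for infinitely many `N`. -/

/-! ### Quantile function: Galois connection with the cdf, transport, continuity -/

/-- Right-continuity of the cdf makes the infimum attained. -/
lemma quantile_le_iff (μ : Measure ℝ) {u : ℝ} (hu : u ∈ Ioo (0 : ℝ) 1) (x : ℝ) :
    quantile μ u ≤ x ↔ u ≤ cdf μ x := by
  refine ⟨fun h => ?_, fun h => (isGLB_quantile μ hu).1 h⟩
  have hc : Tendsto (cdf μ) (𝓝[>] x) (𝓝 (cdf μ x)) :=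
    ((cdf μ).right_continuous x).tendsto.mono_left (nhdsWithin_mono x Ioi_subset_Ici_self)
  refine ge_of_tendsto hc ?_
  filter_upwards [self_mem_nhdsWithin] with y hy
  obtain ⟨z, hz, hzy⟩ := (isGLB_lt_iff (isGLB_quantile μ hu)).1 (lt_of_le_of_lt h hy)
  exact le_trans hz (monotone_cdf μ hzy.le)

lemma lt_quantile_iff (μ : Measure ℝ) {u : ℝ} (hu : u ∈ Ioo (0 : ℝ) 1) (x : ℝ) :
    x < quantile μ u ↔ cdf μ x < u := by
  rw [← not_le, quantile_le_iff μ hu, not_le]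

lemma quantile_mono (μ : Measure ℝ) : MonotoneOn (quantile μ) (Ioo 0 1) :=
  fun _ hu _ hv huv => EReal.coe_le_coe_iff.1 (monotoneOn_quantile μ hu hv huv)

/-- The quantile function transports the uniform law on `(0,1)` to `μ`. -/
lemma map_quantile (μ : Measure ℝ) [IsProbabilityMeasure μ] :
    (volume.restrict (Ioo (0 : ℝ) 1)).map (quantile μ) = μ := by
  have hm : AEMeasurable (quantile μ) (volume.restrict (Ioo (0 : ℝ) 1)) :=
    aemeasurable_restrict_of_monotoneOn measurableSet_Ioo (quantile_mono μ)
  have : IsProbabilityMeasure (volume.restrict (Ioo (0 : ℝ) 1)) := ⟨by simp⟩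
  have := Measure.isProbabilityMeasure_map hm
  refine Measure.ext_of_Iic _ _ fun x => ?_
  rw [Measure.map_apply_of_aemeasurable hm measurableSet_Iic,
    Measure.restrict_apply₀' measurableSet_Ioo.nullMeasurableSet, ← ofReal_cdf μ x]
  have h1 := cdf_le_one μ x
  have hset : quantile μ ⁻¹' Iic x ∩ Ioo 0 1 = Iic (cdf μ x) ∩ Ioo 0 1 := by
    ext u
    refine and_congr_left fun hu => ?_
    exact quantile_le_iff μ hu x
  rw [hset]
  refine le_antisymm ?_ ?_
  · have hs : Iic (cdf μ x) ∩ Ioo 0 1 ⊆ Ioc 0 (cdf μ x) := fun u hu => ⟨hu.2.1, hu.1⟩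
    calc volume (Iic (cdf μ x) ∩ Ioo 0 1) ≤ volume (Ioc 0 (cdf μ x)) := measure_mono hs
      _ = _ := by simp
  · have hs : Ioo 0 (cdf μ x) ⊆ Iic (cdf μ x) ∩ Ioo 0 1 := fun u hu =>
      ⟨hu.2.le, hu.1, hu.2.trans_le h1⟩
    calc ENNReal.ofReal (cdf μ x) = volume (Ioo 0 (cdf μ x)) := by simp
      _ ≤ _ := measure_mono hs

/-- Left-continuity is automatic. If right-continuity fails at `u`, the cdf is stuck at `u` just to
the right of `quantile μ u`, which is a flat piece. -/
lemma continuousOn_quantile_of_strict (μ : Measure ℝ)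
    (h : ¬ ∃ a b : ℝ, a < b ∧ Ioo a b ⊆ {x : ℝ | 0 < cdf μ x ∧ cdf μ x < 1} ∧
        ∃ c : ℝ, ∀ x ∈ Ioo a b, cdf μ x = c) :
    ContinuousOn (quantile μ) (Ioo 0 1) := by
  intro u hu
  refine ContinuousAt.continuousWithinAt (tendsto_order.2 ⟨fun a ha => ?_, fun b hb => ?_⟩)
  · rw [lt_quantile_iff μ hu] at ha
    filter_upwards [lt_mem_nhds ha, Ioo_mem_nhds hu.1 hu.2] with v hv hv1
    exact (lt_quantile_iff μ hv1 a).2 hv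
  · obtain ⟨d, hd, hdb⟩ := exists_between hb
    have hle : u ≤ cdf μ (quantile μ u) := (quantile_le_iff μ hu _).1 le_rfl
    have hlt : u < cdf μ d := by
      by_contra! hn
      have hc : ∀ x ∈ Ioo (quantile μ u) d, cdf μ x = u := fun x hx =>
        le_antisymm ((monotone_cdf μ hx.2.le).trans hn) (hle.trans (monotone_cdf μ hx.1.le))
      refine h ⟨_, d, hd, fun x hx => ?_, u, hc⟩
      simpa only [mem_ofPred_eq, hc x hx, mem_Ioo] using hu
    filter_upwards [gt_mem_nhds hlt, Ioo_mem_nhds hu.1 hu.2] with v hv hv1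
    exact lt_of_le_of_lt ((quantile_le_iff μ hv1 d).2 hv.le) hdb

lemma not_continuousOn_quantile_iff (μ : Measure ℝ) :
    (¬ ContinuousOn (quantile μ) (Ioo 0 1)) ↔
      ∃ a b : ℝ, a < b ∧ Ioo a b ⊆ {x : ℝ | 0 < cdf μ x ∧ cdf μ x < 1} ∧
        ∃ c : ℝ, ∀ x ∈ Ioo a b, cdf μ x = c := by
  refine ⟨fun h => by_contra fun hn => h (continuousOn_quantile_of_strict μ hn), ?_⟩
  rintro ⟨a, b, hab, hsub, c, hc⟩ hcont
  obtain ⟨x, hax, hxb⟩ := exists_between hab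
  obtain ⟨y, hxy, hyb⟩ := exists_between hxb
  have hcx := hc x ⟨hax, hxb⟩
  have hcy := hc y ⟨hax.trans hxy, hyb⟩
  have hc01 : c ∈ Ioo (0 : ℝ) 1 := hcx ▸ hsub ⟨hax, hxb⟩
  have h1 : quantile μ c ≤ x := (quantile_le_iff μ hc01 x).2 hcx.ge
  -- Continuity would give a level `u > c` with quantile below `y`, hence `u ≤ F(y) = c`.
  have hat : ContinuousAt (quantile μ) c := hcont.continuousAt (Ioo_mem_nhds hc01.1 hc01.2)
  have hev : ∀ᶠ u in 𝓝[>] c, quantile μ u < y :=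
    (hat.tendsto.mono_left nhdsWithin_le_nhds).eventually (gt_mem_nhds (h1.trans_lt hxy))
  obtain ⟨u, hu, hu1⟩ := (hev.and (Ioo_mem_nhdsGT hc01.2)).exists
  have := (quantile_le_iff μ ⟨hc01.1.trans hu1.1, hu1.2⟩ y).1 hu.le
  rw [hcy] at this
  exact absurd hu1.1 (not_lt.2 this)

lemma continuousOn_quantile_iff_strictMonoOn (μ : Measure ℝ) :
    ContinuousOn (quantile μ) (Ioo 0 1) ↔
      StrictMonoOn (cdf μ) {x : ℝ | 0 < cdf μ x ∧ cdf μ x < 1} := by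
  rw [← not_iff_not, not_continuousOn_quantile_iff]
  constructor
  · rintro ⟨a, b, hab, hsub, c, hc⟩ hs
    obtain ⟨x, hax, hxb⟩ := exists_between hab
    obtain ⟨y, hxy, hyb⟩ := exists_between hxb
    have hx : x ∈ Ioo a b := ⟨hax, hxb⟩
    have hy : y ∈ Ioo a b := ⟨hax.trans hxy, hyb⟩
    exact (hs (hsub hx) (hsub hy) hxy).ne ((hc x hx).trans (hc y hy).symm)
  · intro hs
    simp only [StrictMonoOn, not_forall, not_lt] at hs
    obtain ⟨x, hx, y, hy, hxy, hle⟩ := hs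
    have hc : ∀ z ∈ Ioo x y, cdf μ z = cdf μ x := fun z hz =>
      le_antisymm ((monotone_cdf μ hz.2.le).trans hle) (monotone_cdf μ hz.1.le)
    refine ⟨x, y, hxy, fun z hz => ?_, _, hc⟩
    simpa only [mem_ofPred_eq, hc z hz] using hx

/-! ### Upper bound -/

section Upper

variable {μ : Measure ℝ} [IsProbabilityMeasure μ] {G : ℝ → ℝ}

lemma restrict_Ioc_eq_sum (N : ℕ) :
    (volume : Measure ℝ).restrict (Ioc ((0 : ℕ) / N : ℝ) (N / N)) =
      ∑ i : Fin N, volume.restrict (Ioc ((i : ℕ) / N : ℝ) (((i : ℕ) + 1 : ℕ) / N)) := by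
  have key : ∀ n : ℕ, (volume : Measure ℝ).restrict (Ioc ((0 : ℕ) / N : ℝ) (n / N)) =
      ∑ i ∈ Finset.range n, volume.restrict (Ioc (i / N : ℝ) ((i + 1 : ℕ) / N)) := by
    intro n
    induction n with
    | zero => simp
    | succ n ih =>
      rw [Finset.sum_range_succ, ← ih, ← Measure.restrict_union
        (Set.disjoint_left.2 fun x hx hx' => absurd hx.2 (not_le.2 hx'.1)) measurableSet_Ioc,
        Ioc_union_Ioc_eq_Ioc]
      · gcongr; simp
      · gcongr; simp
  rw [key N, Finset.sum_range]

/-- Each half of the cell has length `(b - a) / 2` and its own increment of `G`; superadditivity of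
the power merges the two. This is the source of the factor `1/2`. -/
lemma lintegral_Ioc_le {a b : ℝ} (hab : a ≤ b) (hG : MonotoneOn G (Icc a b)) {ρ : ℝ}
    (hρ : 1 ≤ ρ) :
    ∫⁻ u in Ioc a b, ENNReal.ofReal |G ((a + b) / 2) - G u| ^ ρ ≤
      ENNReal.ofReal ((b - a) / 2) * ENNReal.ofReal (G b - G a) ^ ρ := by
  have hρ0 : 0 ≤ ρ := by linarith
  set m := (a + b) / 2 with hm
  have ham : a ≤ m := by rw [hm]; linarith
  have hmb : m ≤ b := by rw [hm]; linarith
  have hGa : G a ≤ G m := hG ⟨le_rfl, hab⟩ ⟨ham, hmb⟩ ham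
  have hGb : G m ≤ G b := hG ⟨ham, hmb⟩ ⟨hab, le_rfl⟩ hmb
  have hb : ∀ {s t : ℝ} (C : ℝ), (∀ u ∈ Ioc s t, |G m - G u| ≤ C) →
      ∫⁻ u in Ioc s t, ENNReal.ofReal |G m - G u| ^ ρ ≤
        ENNReal.ofReal C ^ ρ * ENNReal.ofReal (t - s) := by
    intro s t C h
    rw [← Real.volume_Ioc, ← setLIntegral_const]
    refine setLIntegral_mono' measurableSet_Ioc fun u hu => ?_
    gcongr
    exact h u hu
  have h1 := hb (s := a) (t := m) (G m - G a) fun u hu => by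
    have := hG ⟨le_rfl, hab⟩ ⟨hu.1.le, hu.2.trans hmb⟩ hu.1.le
    have := hG ⟨hu.1.le, hu.2.trans hmb⟩ ⟨ham, hmb⟩ hu.2
    rw [abs_of_nonneg (by linarith)]; linarith
  have h2 := hb (s := m) (t := b) (G b - G m) fun u hu => by
    have := hG ⟨ham.trans hu.1.le, hu.2⟩ ⟨hab, le_rfl⟩ hu.2
    have := hG ⟨ham, hmb⟩ ⟨ham.trans hu.1.le, hu.2⟩ hu.1.le
    rw [abs_of_nonpos (by linarith)]; linarith
  rw [← Ioc_union_Ioc_eq_Ioc ham hmb]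
  refine (lintegral_union_le _ _ _).trans ((add_le_add h1 h2).trans ?_)
  rw [show m - a = (b - a) / 2 by rw [hm]; ring, show b - m = (b - a) / 2 by rw [hm]; ring,
    ← add_mul, mul_comm]
  gcongr
  refine (ENNReal.add_rpow_le_rpow_add _ _ hρ).trans (le_of_eq ?_)
  rw [← ENNReal.ofReal_add (by linarith) (by linarith)]
  congr 2; ring

lemma natCast_div_mem_Icc {N i : ℕ} (hi : i ≤ N) : (i / N : ℝ) ∈ Icc (0 : ℝ) 1 :=
  ⟨by positivity, div_le_one_of_le₀ (by exact_mod_cast hi) (by positivity)⟩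

/-- Coupling the empirical measure of the conditional medians with `μ` through the quantile
function bounds the minimal error by the `ρ`-variation of the quantile function along the regular
subdivision. -/
lemma rpow_mul_minError_le (hG : MonotoneOn G (Icc 0 1)) (hGq : EqOn G (quantile μ) (Ioo 0 1))
    {ρ : ℝ} (hρ : 1 ≤ ρ) {N : ℕ} (hN : 1 ≤ N) :
    (N : ℝ≥0∞) ^ (1 / ρ) * minError N μ ρ ≤
      (2⁻¹ * ∑ i ∈ Finset.range N,
        ENNReal.ofReal (G ((i + 1 : ℕ) / N) - G (i / N)) ^ ρ) ^ (1 / ρ) := by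
  have hρ0 : 0 ≤ 1 / ρ := by positivity
  have hN0 : (0 : ℝ) < N := by exact_mod_cast hN
  let a : ℕ → ℝ := fun i => i / N
  have ha : ∀ i, a i ≤ a (i + 1) := fun i => by simp only [a]; gcongr; simp
  have ham : Monotone a := monotone_nat_of_le_succ ha
  have hmem : ∀ i, i ≤ N → a i ∈ Icc (0 : ℝ) 1 := fun i hi => natCast_div_mem_Icc hi
  have hda : ∀ i, a (i + 1) - a i = 1 / N := fun i => by simp only [a]; push_cast; ring
  let x : Fin N → ℝ := fun i => G ((a i + a (i + 1)) / 2)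
  have hxm : Monotone x := by
    intro i j hij
    have hi := hmem i i.2.le
    have hi' := hmem (i + 1) i.2
    have hj := hmem j j.2.le
    have hj' := hmem (j + 1) j.2
    refine hG ⟨?_, ?_⟩ ⟨?_, ?_⟩ ?_
    · linarith [hi.1, hi'.1]
    · linarith [hi.2, hi'.2]
    · linarith [hj.1, hj'.1]
    · linarith [hj.2, hj'.2]
    · have h1 := ham (show (i : ℕ) ≤ j from hij)
      have h2 := ham (show (i : ℕ) + 1 ≤ j + 1 from Nat.succ_le_succ hij)
      linarith
  let ν : Fin N → Measure ℝ := fun i => volume.restrict (Ioc (a i) (a (i + 1)))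
  have hν : ∑ i, ν i = volume.restrict (Ioc (0 : ℝ) 1) := by
    have := restrict_Ioc_eq_sum N
    rw [div_self hN0.ne', Nat.cast_zero, zero_div] at this
    exact this.symm
  have hGm : ∀ i, AEMeasurable G (ν i) := fun i =>
    aemeasurable_restrict_of_monotoneOn measurableSet_Ioc
      (hG.mono fun u hu => ⟨(hmem i i.2.le).1.trans hu.1.le, hu.2.trans (hmem (i + 1) i.2).2⟩)
  have hpm : ∀ i, AEMeasurable (fun u => (x i, G u)) (ν i) := fun i =>
    aemeasurable_const.prodMk (hGm i)
  let π : Measure (ℝ × ℝ) := ∑ i, (ν i).map fun u => (x i, G u)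
  have hmap : ∀ f : ℝ × ℝ → ℝ, Measurable f →
      π.map f = ∑ i, (ν i).map fun u => f (x i, G u) := by
    intro f hf
    simp only [π]
    rw [← Measure.sum_fintype, Measure.map_sum hf.aemeasurable, Measure.sum_fintype]
    exact Finset.sum_congr rfl fun i _ =>
      AEMeasurable.map_map_of_aemeasurable hf.aemeasurable (hpm i)
  have hπ1 : π.map Prod.fst = empirical x := by
    rw [hmap _ measurable_fst, empirical, Finset.smul_sum]
    refine Finset.sum_congr rfl fun i _ => ?_
    simp only [Measure.map_const, ν, Measure.restrict_apply_univ, Real.volume_Ioc, hda]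
    rw [ENNReal.ofReal_div_of_pos hN0]
    simp
  have hπ2 : π.map Prod.snd = μ := by
    rw [hmap _ measurable_snd]
    simp only
    -- The cells tile `(0,1]`, which differs from `(0,1)` by a null set.
    have hGm' : AEMeasurable G (Measure.sum ν) := AEMeasurable.sum_measure hGm
    rw [← Measure.sum_fintype, ← Measure.map_sum hGm', Measure.sum_fintype, hν,
      ← Measure.restrict_congr_set Ioo_ae_eq_Ioc]
    refine (Measure.map_congr ?_).trans (map_quantile μ)
    filter_upwards [ae_restrict_mem measurableSet_Ioo] with u hu using hGq hu
  have hcost : ∫⁻ p, ENNReal.ofReal |p.1 - p.2| ^ ρ ∂π ≤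
      ∑ i ∈ Finset.range N,
        ENNReal.ofReal (1 / N / 2) * ENNReal.ofReal (G (a (i + 1)) - G (a i)) ^ ρ := by
    simp only [π]
    rw [lintegral_finsetSum_measure, Finset.sum_range]
    refine Finset.sum_le_sum fun i _ => ?_
    have hf : Measurable fun p : ℝ × ℝ => ENNReal.ofReal |p.1 - p.2| ^ ρ :=
      ((measurable_fst.sub measurable_snd).abs.ennreal_ofReal).pow_const ρ
    rw [lintegral_map' hf.aemeasurable (hpm i), ← hda i]
    exact lintegral_Ioc_le (ha i) (hG.mono (Icc_subset_Icc (hmem i i.2.le).1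
      (hmem (i + 1) i.2).2)) hρ
  have hW : minError N μ ρ ≤ (∑ i ∈ Finset.range N,
        ENNReal.ofReal (1 / N / 2) * ENNReal.ofReal (G (a (i + 1)) - G (a i)) ^ ρ) ^ (1 / ρ) :=
    (iInf₂_le x hxm).trans ((iInf₂_le π ⟨hπ1, hπ2⟩).trans (by gcongr))
  calc (N : ℝ≥0∞) ^ (1 / ρ) * minError N μ ρ ≤ _ := mul_le_mul_right hW _
    _ = _ := by
      rw [← ENNReal.mul_rpow_of_nonneg _ _ hρ0, ← Finset.mul_sum, ← mul_assoc]
      congr 2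
      rw [← ENNReal.ofReal_natCast, ← ENNReal.ofReal_mul hN0.le,
        show (N : ℝ) * (1 / N / 2) = 2⁻¹ by field_simp,
        ENNReal.ofReal_inv_of_pos two_pos]
      simp

/-- Superadditivity of the power along a telescoping sum. -/
lemma sum_rpow_sub_le (hG : MonotoneOn G (Icc 0 1)) {ρ : ℝ} (hρ : 1 ≤ ρ) {N : ℕ}
    {n : ℕ} (hn : n ≤ N) :
    ∑ i ∈ Finset.range n, ENNReal.ofReal (G ((i + 1 : ℕ) / N) - G (i / N)) ^ ρ ≤
      ENNReal.ofReal (G (n / N) - G 0) ^ ρ := by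
  have hρ0 : 0 < ρ := by linarith
  have h0 : (0 : ℝ) ∈ Icc (0 : ℝ) 1 := by simp
  induction n with
  | zero => simp
  | succ n ih =>
    have h1 := natCast_div_mem_Icc (N := N) (i := n) (by omega)
    have h2 := natCast_div_mem_Icc hn
    have hG1 := hG h0 h1 h1.1
    have hG2 := hG h1 h2 (by gcongr; simp)
    rw [Finset.sum_range_succ]
    refine (add_le_add_left (ih (by omega)) _).trans
      ((ENNReal.add_rpow_le_rpow_add _ _ hρ).trans (le_of_eq ?_))
    rw [← ENNReal.ofReal_add (by linarith) (by linarith)]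
    congr 2; ring

lemma rpow_mul_minError_le_of_bounds (hG : MonotoneOn G (Icc 0 1))
    (hGq : EqOn G (quantile μ) (Ioo 0 1)) {ρ : ℝ} (hρ : 1 ≤ ρ) {N : ℕ} (hN : 1 ≤ N) :
    (N : ℝ≥0∞) ^ (1 / ρ) * minError N μ ρ ≤
      ENNReal.ofReal (G 1 - G 0) / 2 ^ (1 / ρ) := by
  have hρ0 : 0 < ρ := by linarith
  refine (rpow_mul_minError_le hG hGq hρ hN).trans ?_
  have hs := sum_rpow_sub_le hG hρ (le_refl N)
  rw [div_self (by positivity)] at hs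
  calc _ ≤ (2⁻¹ * ENNReal.ofReal (G 1 - G 0) ^ ρ) ^ (1 / ρ) := by gcongr
    _ = _ := by
      rw [ENNReal.mul_rpow_of_nonneg _ _ (by positivity), ← ENNReal.rpow_mul,
        mul_one_div_cancel hρ0.ne', ENNReal.rpow_one, ENNReal.inv_rpow, mul_comm,
        ENNReal.div_eq_inv_mul, mul_comm]

lemma tendsto_rpow_mul_minError (hG : MonotoneOn G (Icc 0 1)) (hGc : ContinuousOn G (Icc 0 1))
    (hGq : EqOn G (quantile μ) (Ioo 0 1)) {ρ : ℝ} (hρ : 1 < ρ) :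
    Tendsto (fun N : ℕ => (N : ℝ≥0∞) ^ (1 / ρ) * minError N μ ρ) atTop (𝓝 0) := by
  have hρ0 : 0 < ρ := by linarith
  set D := ENNReal.ofReal (G 1 - G 0)
  have huc := isCompact_Icc.uniformContinuousOn_of_continuous hGc
  have hbound : ∀ ε : ℝ, 0 < ε → ∀ᶠ N : ℕ in atTop,
      (N : ℝ≥0∞) ^ (1 / ρ) * minError N μ ρ ≤
        (2⁻¹ * (ENNReal.ofReal ε ^ (ρ - 1) * D)) ^ (1 / ρ) := by
    intro ε hε
    obtain ⟨δ, hδ, hGδ⟩ := Metric.uniformContinuousOn_iff.1 huc ε hε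
    filter_upwards [eventually_ge_atTop 1,
      (tendsto_one_div_atTop_nhds_zero_nat (𝕜 := ℝ)).eventually (gt_mem_nhds hδ)] with N hN hNδ
    refine (rpow_mul_minError_le hG hGq hρ.le hN).trans ?_
    gcongr
    -- Exponent `1` bounds the total increment; the remaining power `ρ - 1` of each increment is
    -- small by uniform continuity.
    have hs := sum_rpow_sub_le hG (le_refl 1) (le_refl N)
    rw [div_self (by positivity)] at hs
    simp only [ENNReal.rpow_one] at hs
    refine le_trans ?_ (mul_le_mul_right hs _)
    rw [Finset.mul_sum]
    refine Finset.sum_le_sum fun i hi => ?_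
    have hiN : i + 1 ≤ N := Finset.mem_range.1 hi
    have h1 := natCast_div_mem_Icc (N := N) (i := i) (by omega)
    have h2 := natCast_div_mem_Icc hiN
    have hd := hGδ _ h2 _ h1 (by
      rw [Real.dist_eq, ← sub_div, Nat.cast_succ, add_sub_cancel_left, abs_of_nonneg (by positivity)]
      exact hNδ)
    rw [Real.dist_eq] at hd
    calc ENNReal.ofReal (G ((i + 1 : ℕ) / N) - G (i / N)) ^ ρ
        = ENNReal.ofReal (G ((i + 1 : ℕ) / N) - G (i / N)) ^ (ρ - 1) *
          ENNReal.ofReal (G ((i + 1 : ℕ) / N) - G (i / N)) := by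
          conv_rhs => rw [← ENNReal.rpow_one (ENNReal.ofReal (G ((i + 1 : ℕ) / N) - G (i / N))),
            ← ENNReal.rpow_mul, ← ENNReal.rpow_add_of_nonneg _ _ (by linarith) (by norm_num)]
          congr 1; ring
      _ ≤ _ := by
          gcongr
          exact (le_abs_self _).trans hd.le
  have hlim : Tendsto (fun ε : ℝ => (2⁻¹ * (ENNReal.ofReal ε ^ (ρ - 1) * D)) ^ (1 / ρ))
      (𝓝[>] 0) (𝓝 0) := by
    have h1 : Tendsto (fun ε : ℝ => ENNReal.ofReal ε ^ (ρ - 1)) (𝓝[>] 0) (𝓝 0) := by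
      have : Continuous fun ε : ℝ => ENNReal.ofReal ε ^ (ρ - 1) :=
        ENNReal.continuous_rpow_const.comp ENNReal.continuous_ofReal
      simpa [ENNReal.zero_rpow_of_pos (sub_pos.2 hρ)] using
        (this.tendsto 0).mono_left (nhdsWithin_le_nhds (s := Ioi 0))
    have h2 := ENNReal.Tendsto.mul_const h1 (b := D) (Or.inr ENNReal.ofReal_ne_top)
    have h3 := ENNReal.Tendsto.const_mul h2 (a := 2⁻¹) (Or.inr (by simp))
    have h4 := (ENNReal.continuous_rpow_const (y := 1 / ρ)).continuousAt.tendsto.comp h3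
    simpa [ENNReal.zero_rpow_of_pos (inv_pos.2 hρ0), Function.comp_def] using h4
  refine ENNReal.tendsto_nhds_zero.2 fun η hη => ?_
  obtain ⟨ε, hε, hε0⟩ := ((hlim.eventually (gt_mem_nhds hη)).and self_mem_nhdsWithin).exists
  filter_upwards [hbound ε hε0] with N hN using hN.trans hε.le

end Upper

/-! ### Endpoints of the quantile function -/

lemma quantileZeroPlus_le (μ : Measure ℝ) {u : ℝ} (hu : u ∈ Ioo (0 : ℝ) 1) :
    quantileZeroPlus μ ≤ quantile μ u := by
  refine le_of_tendsto (tendsto_quantileZeroPlus μ) ?_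
  filter_upwards [Ioo_mem_nhdsGT hu.1] with v hv
  exact monotoneOn_quantile μ ⟨hv.1, hv.2.trans hu.2⟩ hu hv.2.le

lemma le_quantileOne (μ : Measure ℝ) {u : ℝ} (hu : u ∈ Ioo (0 : ℝ) 1) :
    quantile μ u ≤ quantileOne μ := by
  refine ge_of_tendsto (tendsto_quantileOne μ) ?_
  filter_upwards [Ioo_mem_nhdsLT hu.2] with v hv
  exact monotoneOn_quantile μ hu ⟨hu.1.trans hv.1, hv.2⟩ hv.1.le

/-- The quantile function with prescribed values at `0` and `1`. -/
noncomputable def extQuantile (μ : Measure ℝ) (A B : ℝ) (u : ℝ) : ℝ :=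
  if u ≤ 0 then A else if 1 ≤ u then B else quantile μ u

lemma extQuantile_zero (μ : Measure ℝ) (A B : ℝ) : extQuantile μ A B 0 = A := by
  simp [extQuantile]

lemma extQuantile_one (μ : Measure ℝ) (A B : ℝ) : extQuantile μ A B 1 = B := by
  simp [extQuantile]

lemma extQuantile_eqOn (μ : Measure ℝ) (A B : ℝ) :
    EqOn (extQuantile μ A B) (quantile μ) (Ioo 0 1) := fun u hu => by
  simp [extQuantile, not_le.2 hu.1, not_le.2 hu.2]

section Ext

variable {μ : Measure ℝ} {A B : ℝ}

lemma monotoneOn_extQuantile (hA : quantileZeroPlus μ = A) (hB : quantileOne μ = B) :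
    MonotoneOn (extQuantile μ A B) (Icc 0 1) := by
  have h0 : ∀ u ∈ Ioo (0 : ℝ) 1, A ≤ quantile μ u := fun u hu =>
    EReal.coe_le_coe_iff.1 (hA ▸ quantileZeroPlus_le μ hu)
  have h1 : ∀ u ∈ Ioo (0 : ℝ) 1, quantile μ u ≤ B := fun u hu =>
    EReal.coe_le_coe_iff.1 (hB ▸ le_quantileOne μ hu)
  have hAB : A ≤ B := (h0 (1 / 2) (by norm_num)).trans (h1 (1 / 2) (by norm_num))
  intro u _ v _ huv
  unfold extQuantile
  split_ifs with hu hv hv' hu' hv hv' hv hv'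
  · exact le_rfl
  · exact hAB
  · exact h0 v ⟨not_le.1 hv, not_le.1 hv'⟩
  · linarith
  · exact le_rfl
  · linarith
  · linarith
  · exact h1 u ⟨not_le.1 hu, not_le.1 hu'⟩
  · exact quantile_mono μ ⟨not_le.1 hu, not_le.1 hu'⟩ ⟨not_le.1 hv, not_le.1 hv'⟩ huv

lemma continuousOn_extQuantile (hA : quantileZeroPlus μ = A) (hB : quantileOne μ = B)
    (hc : ContinuousOn (quantile μ) (Ioo 0 1)) :
    ContinuousOn (extQuantile μ A B) (Icc 0 1) := by
  have hA' : Tendsto (quantile μ) (𝓝[>] 0) (𝓝 A) :=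
    EReal.tendsto_coe.1 (hA ▸ tendsto_quantileZeroPlus μ)
  have hB' : Tendsto (quantile μ) (𝓝[<] 1) (𝓝 B) :=
    EReal.tendsto_coe.1 (hB ▸ tendsto_quantileOne μ)
  refine (continuousOn_Icc_extendFrom_Ioo hc hA' hB').congr fun u hu => ?_
  rcases eq_or_lt_of_le hu.1 with rfl | h0
  · rw [extQuantile_zero, eq_lim_at_left_extendFrom_Ioo zero_lt_one hA']
  rcases eq_or_lt_of_le hu.2 with rfl | h1
  · rw [extQuantile_one, eq_lim_at_right_extendFrom_Ioo zero_lt_one hB']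
  · rw [extQuantile_eqOn μ A B ⟨h0, h1⟩, extendFrom_extends hc (x := u) ⟨h0, h1⟩]

end Ext

lemma quantile_endpoints_of_isCompact (μ : Measure ℝ) [IsProbabilityMeasure μ]
    (h : IsCompact μ.support) :
    ∃ A B : ℝ, quantileZeroPlus μ = A ∧ quantileOne μ = B := by
  obtain ⟨R, hR⟩ := h.isBounded.subset_closedBall 0
  have hcl : μ (Metric.closedBall 0 R)ᶜ = 0 :=
    measure_mono_null (compl_subset_compl.2 hR) Measure.measure_compl_support
  -- `-R` itself could carry an atom, hence the shift by `1`.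
  have hlow : cdf μ (-R - 1) = 0 := by
    rw [cdf_eq_real, measureReal_eq_zero_iff]
    refine measure_mono_null (fun x hx => ?_) hcl
    simp only [mem_Iic] at hx
    simp only [mem_compl_iff, Metric.mem_closedBall, Real.dist_eq, sub_zero, not_le]
    exact lt_of_lt_of_le (by linarith) (neg_le_abs x)
  have hup : cdf μ R = 1 := by
    have hz : μ (Iic R)ᶜ = 0 := by
      refine measure_mono_null (fun x hx => ?_) hcl
      simp only [mem_compl_iff, mem_Iic, not_le] at hx
      simp only [mem_compl_iff, Metric.mem_closedBall, Real.dist_eq, sub_zero, not_le]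
      exact lt_of_lt_of_le hx (le_abs_self x)
    rw [cdf_eq_real, measureReal_def, (prob_compl_eq_zero_iff measurableSet_Iic).1 hz]
    simp
  have hq : ∀ u ∈ Ioo (0 : ℝ) 1, -R - 1 ≤ quantile μ u ∧ quantile μ u ≤ R := fun u hu =>
    ⟨((lt_quantile_iff μ hu _).2 (hlow ▸ hu.1)).le, (quantile_le_iff μ hu _).2 (hup ▸ hu.2.le)⟩
  have h12 : (1 / 2 : ℝ) ∈ Ioo (0 : ℝ) 1 := by norm_num
  have hA1 := quantileZeroPlus_le μ h12
  have hB1 := le_quantileOne μ h12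
  have hA2 : ((-R - 1 : ℝ) : EReal) ≤ quantileZeroPlus μ := by
    refine ge_of_tendsto (tendsto_quantileZeroPlus μ) ?_
    filter_upwards [Ioo_mem_nhdsGT (zero_lt_one' ℝ)] with v hv
    exact EReal.coe_le_coe_iff.2 (hq v hv).1
  have hB2 : quantileOne μ ≤ (R : EReal) := by
    refine le_of_tendsto (tendsto_quantileOne μ) ?_
    filter_upwards [Ioo_mem_nhdsLT (zero_lt_one' ℝ)] with v hv
    exact EReal.coe_le_coe_iff.2 (hq v hv).2
  exact ⟨_, _, (EReal.coe_toReal (ne_top_of_le_ne_top (EReal.coe_ne_top _) hA1)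
    (ne_bot_of_le_ne_bot (EReal.coe_ne_bot _) hA2)).symm,
    (EReal.coe_toReal (ne_top_of_le_ne_top (EReal.coe_ne_top _) hB2)
    (ne_bot_of_le_ne_bot (EReal.coe_ne_bot _) hB1)).symm⟩

lemma rpow_mul_minError_le_range (μ : Measure ℝ) [IsProbabilityMeasure μ] {ρ : ℝ} (hρ : 1 ≤ ρ)
    {N : ℕ} (hN : 1 ≤ N) :
    (N : ℝ≥0∞) ^ (1 / ρ) * minError N μ ρ ≤
      (quantileOne μ - quantileZeroPlus μ).toENNReal / (2 : ℝ≥0∞) ^ (1 / ρ) := by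
  have h12 : (1 / 2 : ℝ) ∈ Ioo (0 : ℝ) 1 := by norm_num
  have hA1 : quantileZeroPlus μ ≠ ⊤ :=
    ne_top_of_le_ne_top (EReal.coe_ne_top _) (quantileZeroPlus_le μ h12)
  have hB1 : quantileOne μ ≠ ⊥ := ne_bot_of_le_ne_bot (EReal.coe_ne_bot _) (le_quantileOne μ h12)
  have h2 : (2 : ℝ≥0∞) ^ (1 / ρ) ≠ ⊤ := ENNReal.rpow_ne_top_of_nonneg (by positivity) (by simp)
  -- An infinite endpoint makes the right-hand side `⊤`.
  by_cases hA : quantileZeroPlus μ = ⊥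
  · rw [hA, EReal.sub_bot hB1, EReal.toENNReal_top, ENNReal.top_div_of_ne_top h2]
    exact le_top
  by_cases hB : quantileOne μ = ⊤
  · rw [hB, EReal.top_sub hA1, EReal.toENNReal_top, ENNReal.top_div_of_ne_top h2]
    exact le_top
  have hA' := (EReal.coe_toReal hA1 hA).symm
  have hB' := (EReal.coe_toReal hB hB1).symm
  have := rpow_mul_minError_le_of_bounds (monotoneOn_extQuantile hA' hB')
    (extQuantile_eqOn μ _ _) hρ hN
  rwa [extQuantile_zero, extQuantile_one, ← EReal.real_coe_toENNReal, EReal.coe_sub,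
    ← hA', ← hB'] at this

/-! ### Lower bound -/

/-- If `n * c` and `(n + 1) * c` were both within `min c (1 - c) / 2` of integers `k` and `l`, then
`l - k` would lie strictly between `0` and `1`. -/
lemma frequently_le_abs_sub (c : ℝ) :
    ∃ᶠ N : ℕ in atTop, ∀ k : ℕ, min c (1 - c) / 2 ≤ |(k : ℝ) - N * c| := by
  refine frequently_atTop.2 fun n => ?_
  by_contra! h
  obtain ⟨k, hk⟩ := h n le_rfl
  obtain ⟨l, hl⟩ := h (n + 1) (Nat.le_succ n)
  rw [abs_lt] at hk hl
  have h1 := min_le_left c (1 - c)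
  have h2 := min_le_right c (1 - c)
  push_cast at hl
  have h3 : (k : ℝ) < l := by linarith [hk.1, hk.2, hl.1, hl.2]
  have h4 : (l : ℝ) < k + 1 := by linarith [hk.1, hk.2, hl.1, hl.2]
  norm_cast at h3 h4
  omega

lemma empirical_Iic {N : ℕ} (x : Fin N → ℝ) (m : ℝ) :
    ∃ k : ℕ, empirical x (Iic m) = (N : ℝ≥0∞)⁻¹ * k := by
  classical
  refine ⟨(Finset.univ.filter fun i => x i ≤ m).card, ?_⟩
  simp [empirical, Measure.dirac_apply' _ measurableSet_Iic, indicator_apply]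

/-- A pair with one coordinate on each side of a strip of width `δ` is at distance at least `δ`. -/
lemma le_measure_of_coupling {ν η : Measure ℝ} {π : Measure (ℝ × ℝ)}
    (h1 : π.map Prod.fst = ν) (h2 : π.map Prod.snd = η) {m δ : ℝ} :
    ν (Iic m) ≤ η (Iic (m + δ)) + π {p | ENNReal.ofReal δ ≤ ENNReal.ofReal |p.1 - p.2|} ∧
    η (Iic (m - δ)) ≤ ν (Iic m) + π {p | ENNReal.ofReal δ ≤ ENNReal.ofReal |p.1 - p.2|} := by
  rw [← h1, ← h2, Measure.map_apply measurable_fst measurableSet_Iic,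
    Measure.map_apply measurable_snd measurableSet_Iic,
    Measure.map_apply measurable_snd measurableSet_Iic]
  constructor
  · refine (measure_mono fun p hp => ?_).trans (measure_union_le _ _)
    simp only [mem_preimage, mem_Iic, mem_union, mem_ofPred_eq] at hp ⊢
    refine or_iff_not_imp_left.2 fun h => ENNReal.ofReal_le_ofReal ?_
    exact le_trans (by linarith) (neg_le_abs _)
  · refine (measure_mono fun p hp => ?_).trans (measure_union_le _ _)
    simp only [mem_preimage, mem_Iic, mem_union, mem_ofPred_eq] at hp ⊢
    refine or_iff_not_imp_left.2 fun h => ENNReal.ofReal_le_ofReal ?_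
    exact le_trans (by linarith) (le_abs_self _)

/-- Markov's inequality for the transport cost, once the mass moved by at least `δ` is known to be
at least `η / N`. -/
lemma le_rpow_mul_minError (μ : Measure ℝ) [IsProbabilityMeasure μ] {m δ c η ρ : ℝ}
    (hlow : cdf μ (m - δ) = c) (hup : cdf μ (m + δ) = c) (hρ : 1 ≤ ρ) {N : ℕ} (hN : 1 ≤ N)
    (hη : ∀ k : ℕ, η ≤ |(k : ℝ) - N * c|) :
    (ENNReal.ofReal δ ^ ρ * ENNReal.ofReal η) ^ (1 / ρ) ≤
      (N : ℝ≥0∞) ^ (1 / ρ) * minError N μ ρ := by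
  have hρ0 : 0 < ρ := by linarith
  have hN0 : (0 : ℝ) < N := by exact_mod_cast hN
  have hNe : (N : ℝ≥0∞) ≠ 0 := by exact_mod_cast (by omega : N ≠ 0)
  have hNp : (N : ℝ≥0∞) ^ (1 / ρ) ≠ 0 := by simp [hNe]
  have hNt : (N : ℝ≥0∞) ^ (1 / ρ) ≠ ⊤ :=
    ENNReal.rpow_ne_top_of_nonneg (by positivity) (by simp)
  refine (ENNReal.div_le_iff_le_mul (Or.inl hNp) (Or.inl hNt)).1 ?_ |>.trans_eq (mul_comm _ _)
  refine le_iInf₂ fun x _ => le_iInf₂ fun π hπ => ?_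
  refine (ENNReal.div_le_iff_le_mul (Or.inl hNp) (Or.inl hNt)).2 ?_
  rw [← ENNReal.mul_rpow_of_nonneg _ _ (by positivity)]
  refine ENNReal.rpow_le_rpow ?_ (by positivity)
  set S : Set (ℝ × ℝ) := {p | ENNReal.ofReal δ ≤ ENNReal.ofReal |p.1 - p.2|} with hS
  have hcost : ENNReal.ofReal δ ^ ρ * π S ≤ ∫⁻ p, ENNReal.ofReal |p.1 - p.2| ^ ρ ∂π := by
    have hf : Measurable fun p : ℝ × ℝ => ENNReal.ofReal |p.1 - p.2| ^ ρ :=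
      ((measurable_fst.sub measurable_snd).abs.ennreal_ofReal).pow_const ρ
    refine le_trans ?_ (mul_meas_ge_le_lintegral hf (ENNReal.ofReal δ ^ ρ))
    gcongr
    intro p hp
    exact ENNReal.rpow_le_rpow hp hρ0.le
  have hmass : ENNReal.ofReal η ≤ π S * N := by
    obtain ⟨k, hk⟩ := empirical_Iic x m
    obtain ⟨h1, h2⟩ := le_measure_of_coupling hπ.1 hπ.2 (m := m) (δ := δ)
    rw [hk, ← ofReal_cdf μ, hup] at h1
    rw [hk, ← ofReal_cdf μ, hlow] at h2
    rcases eq_or_ne (π S) ⊤ with ht | ht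
    · rw [ht, ENNReal.top_mul hNe]; exact le_top
    have hc0 : 0 ≤ c := hup ▸ cdf_nonneg μ _
    have hkr : (N : ℝ≥0∞)⁻¹ * k = ENNReal.ofReal ((N : ℝ)⁻¹ * k) := by
      rw [ENNReal.ofReal_mul (by positivity), ENNReal.ofReal_inv_of_pos hN0]; simp
    have hp : π S = ENNReal.ofReal (π S).toReal := (ENNReal.ofReal_toReal ht).symm
    rw [hkr, ← hS, hp, ← ENNReal.ofReal_add (by positivity) (by positivity),
      ENNReal.ofReal_le_ofReal_iff (by positivity)] at h1 h2
    rw [hp, ← ENNReal.ofReal_natCast, ← ENNReal.ofReal_mul (by positivity)]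
    refine ENNReal.ofReal_le_ofReal ((hη k).trans (abs_le.2 ?_))
    have e : (k : ℝ) = (N : ℝ)⁻¹ * k * N := by field_simp
    constructor
    · have := mul_le_mul_of_nonneg_right h2 hN0.le
      rw [add_mul, ← e] at this; linarith
    · have := mul_le_mul_of_nonneg_right h1 hN0.le
      rw [add_mul, ← e] at this; linarith
  calc ENNReal.ofReal δ ^ ρ * ENNReal.ofReal η ≤ ENNReal.ofReal δ ^ ρ * (π S * N) := by gcongr
    _ = ENNReal.ofReal δ ^ ρ * π S * N := (mul_assoc _ _ _).symm
    _ ≤ _ := by gcongr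

lemma limsup_pos_of_gap (μ : Measure ℝ) [IsProbabilityMeasure μ] {a b c ρ : ℝ} (hab : a < b)
    (hsub : Ioo a b ⊆ {x : ℝ | 0 < cdf μ x ∧ cdf μ x < 1}) (hc : ∀ x ∈ Ioo a b, cdf μ x = c)
    (hρ : 1 ≤ ρ) :
    0 < limsup (fun N : ℕ => (N : ℝ≥0∞) ^ (1 / ρ) * minError N μ ρ) atTop := by
  -- Quarter points keep `m ± δ` inside the open gap.
  have hl : (a + b) / 2 - (b - a) / 4 ∈ Ioo a b := ⟨by linarith, by linarith⟩
  have hu : (a + b) / 2 + (b - a) / 4 ∈ Ioo a b := ⟨by linarith, by linarith⟩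
  have hc01 : c ∈ Ioo (0 : ℝ) 1 := hc _ hl ▸ hsub hl
  have hδ : 0 < ENNReal.ofReal ((b - a) / 4) := ENNReal.ofReal_pos.2 (by linarith)
  have hη : 0 < ENNReal.ofReal (min c (1 - c) / 2) :=
    ENNReal.ofReal_pos.2 (half_pos (lt_min hc01.1 (sub_pos.2 hc01.2)))
  have hpos : 0 < (ENNReal.ofReal ((b - a) / 4) ^ ρ *
      ENNReal.ofReal (min c (1 - c) / 2)) ^ (1 / ρ) :=
    ENNReal.rpow_pos (ENNReal.mul_pos (ENNReal.rpow_pos hδ ENNReal.ofReal_ne_top).ne' hη.ne')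
      (ENNReal.mul_ne_top (ENNReal.rpow_ne_top_of_nonneg (by linarith) ENNReal.ofReal_ne_top)
        ENNReal.ofReal_ne_top)
  refine hpos.trans_le (le_limsup_of_frequently_le ?_)
  refine ((frequently_le_abs_sub c).and_eventually (eventually_ge_atTop 1)).mono ?_
  rintro N ⟨h, hN⟩
  exact le_rpow_mul_minError μ (hc _ hl) (hc _ hu) hρ hN h

end EmpiricalApprox

theorem proposition2 (μ : Measure ℝ) [IsProbabilityMeasure μ] :
    -- the uniform upper bound
    (∀ ρ : ℝ, 1 ≤ ρ →
      (⨆ (N : ℕ) (_ : 1 ≤ N), (N : ℝ≥0∞) ^ (1 / ρ) * EmpiricalApprox.minError N μ ρ) ≤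
        (EmpiricalApprox.quantileOne μ - EmpiricalApprox.quantileZeroPlus μ).toENNReal /
          (2 : ℝ≥0∞) ^ (1 / ρ)) ∧
    -- discontinuity of the quantile function, its characterization, and the lower bound
    ((¬ ContinuousOn (EmpiricalApprox.quantile μ) (Ioo 0 1)) ↔
      ∃ a b : ℝ, a < b ∧ Ioo a b ⊆ {x : ℝ | 0 < cdf μ x ∧ cdf μ x < 1} ∧
        ∃ c : ℝ, ∀ x ∈ Ioo a b, cdf μ x = c) ∧
    ((¬ ContinuousOn (EmpiricalApprox.quantile μ) (Ioo 0 1)) →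
      ∀ ρ : ℝ, 1 ≤ ρ →
        0 < limsup (fun N : ℕ => (N : ℝ≥0∞) ^ (1 / ρ) * EmpiricalApprox.minError N μ ρ) atTop) ∧
    -- continuity of the quantile function, its characterization, and the limit for `ρ > 1`
    (ContinuousOn (EmpiricalApprox.quantile μ) (Ioo 0 1) ↔
      StrictMonoOn (cdf μ) {x : ℝ | 0 < cdf μ x ∧ cdf μ x < 1}) ∧
    (IsCompact μ.support → ContinuousOn (EmpiricalApprox.quantile μ) (Ioo 0 1) →
      ∀ ρ : ℝ, 1 < ρ →
        Tendsto (fun N : ℕ => (N : ℝ≥0∞) ^ (1 / ρ) * EmpiricalApprox.minError N μ ρ)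
          atTop (𝓝 0)) := by
  open EmpiricalApprox in
  refine ⟨fun ρ hρ => iSup₂_le fun N hN => rpow_mul_minError_le_range μ hρ hN,
    not_continuousOn_quantile_iff μ, fun h ρ hρ => ?_,
    continuousOn_quantile_iff_strictMonoOn μ, fun hs hc ρ hρ => ?_⟩
  · obtain ⟨a, b, hab, hsub, c, hcc⟩ := (not_continuousOn_quantile_iff μ).1 h
    exact limsup_pos_of_gap μ hab hsub hcc hρ
  · obtain ⟨A, B, hA, hB⟩ := quantile_endpoints_of_isCompact μ hs
    exact tendsto_rpow_mul_minError (monotoneOn_extQuantile hA hB)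
      (continuousOn_extQuantile hA hB hc) (extQuantile_eqOn μ A B) hρ
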